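/- Let $N \ge 1$ and let $\Omega \subset \mathbb{R}^N$ be a bounded open set. Let $H^1_0(\Omega)$ be the closure of $C_c^\infty(\Omega)$ in the norm $\|u\|_{H^1_0} = (\|u\|_{L^2(\Omega)}^2 + \|\nabla u\|_{L^2(\Omega)}^2)^{1/2}$ (real-valued functions), and let $H^{-1}(\Omega)$ be its dual space with the dual norm. For $\alpha > 0$ and $d \in L^\infty(\Omega)$ let $B = B_{\alpha,d} : H^1_0(\Omega)^2 \to H^{-1}(\Omega)^2$ be the bounded linear operator $$B = \begin{pmatrix} \frac1\alpha I & -\Delta \\ -\Delta & -D \end{pmatrix}, \qquad B(w,\psi) = \left( \tfrac1\alpha w - \Delta \psi,\; -\Delta w - d\psi \right),$$ where $I, -\Delta, D : H^1_0(\Omega) \to H^{-1}(\Omega)$ are given by $\langle I u, v\rangle = \int_\Omega u v\,dx$, $\langle -\Delta u, v\rangle = \int_\Omega \nabla u \cdot \nabla v\,dx$ and $\langle D u, v\rangle = \int_\Omega d\,u\,v\,dx$. Product spaces carry the maximum norm. Then there are a threshold $\alpha_0(M)$ and a constant $C(\alpha, M)$, depending (besides on the fixed set $\Omega$) only on $M$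 and only on $\alpha$ and $M$, respectively, such that the following holds for all $M > 0$, all $\alpha > 0$ and all $d \in L^\infty(\Omega)$ with $\|d\|_{L^\infty(\Omega)} \le M$: if $d \ge 0$ almost everywhere in $\Omega$, or if $\alpha \ge \alpha_0(M)$, then $B$ has a bounded inverse $B^{-1} : H^{-1}(\Omega)^2 \to H^1_0(\Omega)^2$, and $$\|B^{-1}\|_{\mathcal{L}(H^{-1}(\Omega)^2,\, H^1_0(\Omega)^2)} \le C(\alpha, M).$$ -/

import Mathlib

open MeasureTheory
open scoped ENNReal ContDiff

set_option maxSynthPendingDepth 3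

noncomputable section

namespace BlockOp

/-- Lebesgue measure on `Ω ⊆ ℝᴺ`. -/
abbrev vol {N : ℕ} (Ω : Set (EuclideanSpace ℝ (Fin N))) : Measure (EuclideanSpace ℝ (Fin N)) :=
  volume.restrict Ω

/-- The real Lebesgue space `L²(Ω)`. -/
abbrev L2 {N : ℕ} (Ω : Set (EuclideanSpace ℝ (Fin N))) := Lp ℝ 2 (vol Ω)

/-- The space `L²(Ω)ᴺ` of square integrable vector fields, where `ℝᴺ` has the Euclidean norm. -/
abbrev L2Vec {N : ℕ} (Ω : Set (EuclideanSpace ℝ (Fin N))) :=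
  Lp (EuclideanSpace ℝ (Fin N)) 2 (vol Ω)

/-- The Hilbert space `L²(Ω) × L²(Ω)ᴺ` with `‖(u, g)‖² = ‖u‖² + ‖g‖²`. A function `u` in `H¹(Ω)`
is represented in it by the pair `(u, ∇u)`, so that the induced norm is the norm of `H¹(Ω)`. -/
abbrev Graph {N : ℕ} (Ω : Set (EuclideanSpace ℝ (Fin N))) := WithLp 2 (L2 Ω × L2Vec Ω)

/-- `φ ∈ C_c^∞(Ω)`. -/
structure IsTest {N : ℕ} (Ω : Set (EuclideanSpace ℝ (Fin N)))
    (φ : EuclideanSpace ℝ (Fin N) → ℝ) : Prop where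
  smooth : ContDiff ℝ ∞ φ
  compact : HasCompactSupport φ
  supp : tsupport φ ⊆ Ω

/-- The linear space of all pairs `(φ, ∇φ)` with `φ ∈ C_c^∞(Ω)`. -/
def testPairs {N : ℕ} (Ω : Set (EuclideanSpace ℝ (Fin N))) : Submodule ℝ (Graph Ω) where
  carrier := {p | ∃ φ, IsTest Ω φ ∧ p.fst =ᵐ[vol Ω] φ ∧ p.snd =ᵐ[vol Ω] fun x => gradient φ x}
  zero_mem' := by
    refine ⟨fun _ => 0, ⟨contDiff_const, HasCompactSupport.zero, ?_⟩, ?_, ?_⟩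
    · simp [tsupport]
    · exact Lp.coeFn_zero _ _ _
    · filter_upwards [Lp.coeFn_zero (EuclideanSpace ℝ (Fin N)) 2 (vol Ω)] with x hx
      simpa [gradient_fun_const] using hx
  add_mem' := by
    rintro p q ⟨φ, hφ, hp, hp'⟩ ⟨ψ, hψ, hq, hq'⟩
    refine ⟨fun x => φ x + ψ x, ⟨hφ.smooth.add hψ.smooth, hφ.compact.add hψ.compact, ?_⟩, ?_, ?_⟩
    · exact (tsupport_add φ ψ).trans (Set.union_subset hφ.supp hψ.supp)
    · filter_upwards [Lp.coeFn_add p.fst q.fst, hp, hq] with x h h1 h2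
      simpa [h1, h2] using h
    · filter_upwards [Lp.coeFn_add p.snd q.snd, hp', hq'] with x h h1 h2
      have e : gradient (fun x => φ x + ψ x) x = gradient φ x + gradient ψ x := by
        rw [gradient, gradient, gradient, ← map_add]
        congr 1
        exact fderiv_fun_add (hφ.smooth.differentiable (by simp) x)
          (hψ.smooth.differentiable (by simp) x)
      rw [e]
      simpa [h1, h2] using h
  smul_mem' := by
    rintro c p ⟨φ, hφ, hp, hp'⟩
    refine ⟨fun x => c * φ x, ⟨contDiff_const.mul hφ.smooth, hφ.compact.mul_left, ?_⟩, ?_, ?_⟩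
    · exact (tsupport_mul_subset_right (f := fun _ => c) (g := φ)).trans hφ.supp
    · filter_upwards [Lp.coeFn_smul c p.fst, hp] with x h h1
      simpa [h1] using h
    · filter_upwards [Lp.coeFn_smul c p.snd, hp'] with x h h1
      have e : gradient (fun x => c * φ x) x = c • gradient φ x := by
        rw [gradient, gradient, fderiv_const_mul (hφ.smooth.differentiable (by simp) x)]
        simp
      rw [e]
      simpa [h1] using h

/-- The Sobolev space `H¹₀(Ω)`: the closure of `C_c^∞(Ω)` in the `H¹`-norm
`(‖u‖²_{L²} + ‖∇u‖²_{L²})^{1/2}`. An element is recorded as the pair of a function and its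
(weak) gradient. -/
def H10 {N : ℕ} (Ω : Set (EuclideanSpace ℝ (Fin N))) : Submodule ℝ (Graph Ω) :=
  (testPairs Ω).topologicalClosure

/-- `H⁻¹(Ω)`, the topological dual of `H¹₀(Ω)` with the dual norm. -/
abbrev HNeg {N : ℕ} (Ω : Set (EuclideanSpace ℝ (Fin N))) := StrongDual ℝ (H10 Ω)

variable {N : ℕ} (Ω : Set (EuclideanSpace ℝ (Fin N)))

/-- The embedding `H¹₀(Ω) → L²(Ω)`. -/
def toL2 : H10 Ω →L[ℝ] L2 Ω := (WithLp.fstL 2 ℝ (L2 Ω) (L2Vec Ω)).comp (H10 Ω).subtypeL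

/-- The weak gradient `H¹₀(Ω) → L²(Ω)ᴺ`. -/
def grad : H10 Ω →L[ℝ] L2Vec Ω := (WithLp.sndL 2 ℝ (L2 Ω) (L2Vec Ω)).comp (H10 Ω).subtypeL

/-- `-Δ : H¹₀(Ω) → H⁻¹(Ω)`, `⟨-Δu, v⟩ = ∫_Ω ∇u · ∇v dx`. -/
def negLap : H10 Ω →L[ℝ] HNeg Ω := (innerSL ℝ).bilinearComp (grad Ω) (grad Ω)

theorem negLap_apply (u v : H10 Ω) :
    negLap Ω u v = ∫ x in Ω, inner ℝ (grad Ω u x) (grad Ω v x) := rfl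

/-- The embedding `L²(Ω) → H⁻¹(Ω)`, `⟨f, v⟩ = ∫_Ω f v dx`. -/
def ofL2 : L2 Ω →L[ℝ] HNeg Ω :=
  (innerSL ℝ).bilinearComp (ContinuousLinearMap.id ℝ (L2 Ω)) (toL2 Ω)

theorem ofL2_apply (f : L2 Ω) (v : H10 Ω) : ofL2 Ω f v = ∫ x in Ω, f x * toL2 Ω v x := by
  change ∫ x in Ω, inner ℝ (f x) (toL2 Ω v x) = _
  simp [mul_comm]

/-- Pointwise multiplication `L²(Ω) → L²(Ω)`, `f ↦ d f`, by `d ∈ L^∞(Ω)`. -/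
def mulLinf (d : Lp ℝ ∞ (vol Ω)) : L2 Ω →L[ℝ] L2 Ω :=
  (ContinuousLinearMap.mul ℝ ℝ).holderL (vol Ω) ∞ 2 2 d

theorem mulLinf_coe (d : Lp ℝ ∞ (vol Ω)) (f : L2 Ω) :
    mulLinf Ω d f =ᵐ[vol Ω] fun x => d x * f x :=
  (ContinuousLinearMap.mul ℝ ℝ).coeFn_holder d f

/-- `I : H¹₀(Ω) → H⁻¹(Ω)`, the identity, with `⟨I u, v⟩ = ∫_Ω u v dx`. -/
def idOp : H10 Ω →L[ℝ] HNeg Ω := (ofL2 Ω).comp (toL2 Ω)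

/-- `D : H¹₀(Ω) → H⁻¹(Ω)`, pointwise multiplication by `d`, with `⟨D u, v⟩ = ∫_Ω d u v dx`. -/
def mulOp (d : Lp ℝ ∞ (vol Ω)) : H10 Ω →L[ℝ] HNeg Ω :=
  (ofL2 Ω).comp ((mulLinf Ω d).comp (toL2 Ω))

/-- The block operator
`B (w, ψ) = (α⁻¹ w - Δψ, -Δw - D ψ)` from `H¹₀(Ω)²` to `H⁻¹(Ω)²`. -/
def blockOp (α : ℝ) (d : Lp ℝ ∞ (vol Ω)) : (H10 Ω × H10 Ω) →L[ℝ] (HNeg Ω × HNeg Ω) :=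
  ((α⁻¹ • idOp Ω).coprod (negLap Ω)).prod ((negLap Ω).coprod (-mulOp Ω d))

theorem blockOp_apply (α : ℝ) (d : Lp ℝ ∞ (vol Ω)) (w ψ : H10 Ω) :
    blockOp Ω α d (w, ψ) = (α⁻¹ • idOp Ω w + negLap Ω ψ, negLap Ω w - mulOp Ω d ψ) := by
  simp [blockOp, sub_eq_add_neg]

end BlockOp

end

/-! ### Lax–Milgram for block operators with a twisted test pair -/

open BlockOp

/-! Pair `B (w, ψ)` with `(a w + ψ, b w - a ψ)`. The terms `± a ∫ ∇w · ∇ψ` cancel, leaving `‖∇ψ‖² +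
b ‖∇w‖² + (a/α) ‖w‖² + a ∫ d ψ²` and the cross terms `α⁻¹ ∫ w ψ - b ∫ d ψ w`. Coercivity follows
once the cross terms are absorbed, using the Poincaré constant `P` of `Ω`. If `d ≥ 0`, take `b = 1`
and `a` so large that `(a/α) ‖w‖²` and half of `‖∇ψ‖²` absorb them
(`isInvertible_blockOp_of_nonneg`). If `α` is large, take `a = 0`, which removes the term of unknown
sign, and `b` small (`isInvertible_blockOp_of_le`). The test map is a linear bijection of
determinant `-(a² + b) ≠ 0`, so Lax–Milgram inverts `B` itself. -/

/-- A block operator `H × H → H* × H*` that is coercive when tested against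
`(a w + ψ, b w - a ψ)` is invertible, with a bound on its inverse. -/
theorem isInvertible_of_block_coercive {H : Type*} [NormedAddCommGroup H] [InnerProductSpace ℝ H]
    [CompleteSpace H] (B : (H × H) →L[ℝ] (StrongDual ℝ H × StrongDual ℝ H)) {a b c : ℝ}
    (ha : 0 ≤ a) (hb : 0 < b) (hc : 0 < c)
    (h : ∀ w ψ : H, c * (‖w‖ ^ 2 + ‖ψ‖ ^ 2) ≤
      (B (w, ψ)).1 (a • w + ψ) + (B (w, ψ)).2 (b • w - a • ψ)) :
    B.IsInvertible ∧ ‖B.inverse‖ ≤ (1 + 2 * a + b) / c := by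
  -- The factor `1 + 2a + b` is `(a + 1) + (a + b)`, from the norms of the two test components.
  have bound : ∀ x : H × H, ‖x‖ ≤ (1 + 2 * a + b) / c * ‖B x‖ := by
    rintro ⟨w, ψ⟩
    set x : H × H := (w, ψ)
    have hw : ‖w‖ ≤ ‖x‖ := norm_fst_le x
    have hψ : ‖ψ‖ ≤ ‖x‖ := norm_snd_le x
    have hx : ‖x‖ ^ 2 ≤ ‖w‖ ^ 2 + ‖ψ‖ ^ 2 := by
      rcases max_choice ‖w‖ ‖ψ‖ with e | e <;>
        · rw [show ‖x‖ = max ‖w‖ ‖ψ‖ from rfl, e]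
          nlinarith [sq_nonneg ‖w‖, sq_nonneg ‖ψ‖]
    have h1 : (B x).1 (a • w + ψ) ≤ ‖B x‖ * ((a + 1) * ‖x‖) := by
      refine (le_abs_self _).trans (((B x).1.le_opNorm _).trans ?_)
      gcongr
      · exact norm_fst_le _
      · refine (norm_add_le _ _).trans ?_
        rw [norm_smul, Real.norm_of_nonneg ha]
        nlinarith
    have h2 : (B x).2 (b • w - a • ψ) ≤ ‖B x‖ * ((a + b) * ‖x‖) := by
      refine (le_abs_self _).trans (((B x).2.le_opNorm _).trans ?_)
      gcongr
      · exact norm_snd_le _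
      · refine (norm_sub_le _ _).trans ?_
        rw [norm_smul, norm_smul, Real.norm_of_nonneg ha, Real.norm_of_nonneg hb.le]
        nlinarith
    have h3 : c * ‖x‖ ^ 2 ≤ (1 + 2 * a + b) * ‖B x‖ * ‖x‖ := by
      have := h w ψ
      nlinarith
    rw [div_mul_eq_mul_div, le_div_iff₀ hc]
    rcases (norm_nonneg x).eq_or_lt with h0 | h0
    · rw [← h0]; simpa using by positivity
    · exact le_of_mul_le_mul_right (by nlinarith) h0
  -- Lax–Milgram needs a Hilbert space, so the maximum norm is replaced by the `ℓ²` product norm.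
  let V := WithLp 2 (H × H)
  let p₁ : V →L[ℝ] H := WithLp.fstL 2 ℝ H H
  let p₂ : V →L[ℝ] H := WithLp.sndL 2 ℝ H H
  let BV : V →L[ℝ] (StrongDual ℝ H × StrongDual ℝ H) := B.comp (p₁.prod p₂)
  let T : V →L[ℝ] V →L[ℝ] ℝ :=
    ((ContinuousLinearMap.fst ℝ _ _).comp BV).bilinearComp (.id ℝ V) (a • p₁ + p₂) +
    ((ContinuousLinearMap.snd ℝ _ _).comp BV).bilinearComp (.id ℝ V) (b • p₁ - a • p₂)
  have hT : ∀ x y : V, T x y = (B (x.fst, x.snd)).1 (a • y.fst + y.snd) +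
      (B (x.fst, x.snd)).2 (b • y.fst - a • y.snd) := fun x y => rfl
  have coer : IsCoercive T := by
    refine ⟨c, hc, fun x => ?_⟩
    rw [hT, mul_assoc, ← sq, WithLp.prod_norm_sq_eq_of_L2]
    exact h _ _
  have surj : Function.Surjective B := by
    rintro ⟨f, g⟩
    let l : StrongDual ℝ V := f.comp (a • p₁ + p₂) + g.comp (b • p₁ - a • p₂)
    let x : V := coer.continuousLinearEquivOfBilin.symm ((InnerProductSpace.toDual ℝ V).symm l)
    have hx : ∀ y, T x y = l y := fun y => by
      rw [← coer.continuousLinearEquivOfBilin_apply]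
      simp [x]
    have key : ∀ u v : H, (B (x.fst, x.snd)).1 u + (B (x.fst, x.snd)).2 v = f u + g v := by
      intro u v
      have hk : a ^ 2 + b ≠ 0 := by positivity
      -- This vector is the preimage of `(u, v)` under the test map.
      have := hx (WithLp.toLp 2
        ((a ^ 2 + b)⁻¹ • (a • u + v), (a ^ 2 + b)⁻¹ • (b • u - a • v)))
      have e1 : a • ((a ^ 2 + b)⁻¹ • (a • u + v)) + (a ^ 2 + b)⁻¹ • (b • u - a • v) = u := by
        match_scalars <;> field_simp
        ring
      have e2 : b • ((a ^ 2 + b)⁻¹ • (a • u + v)) - a • ((a ^ 2 + b)⁻¹ • (b • u - a • v)) = v := by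
        match_scalars <;> field_simp <;> ring
      change (B (x.fst, x.snd)).1
          (a • ((a ^ 2 + b)⁻¹ • (a • u + v)) + (a ^ 2 + b)⁻¹ • (b • u - a • v)) +
        (B (x.fst, x.snd)).2
          (b • ((a ^ 2 + b)⁻¹ • (a • u + v)) - a • ((a ^ 2 + b)⁻¹ • (b • u - a • v))) =
        f (a • ((a ^ 2 + b)⁻¹ • (a • u + v)) + (a ^ 2 + b)⁻¹ • (b • u - a • v)) +
        g (b • ((a ^ 2 + b)⁻¹ • (a • u + v)) - a • ((a ^ 2 + b)⁻¹ • (b • u - a • v))) at this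
      simpa only [e1, e2] using this
    refine ⟨(x.fst, x.snd), Prod.ext ?_ ?_⟩
    · ext u; simpa using key u 0
    · ext v; simpa using key 0 v
  have inj : B.ker = ⊥ := by
    refine (LinearMap.ker_eq_bot' ).2 fun x hx => ?_
    have := bound x
    rw [show B x = 0 from hx] at this
    simpa using this
  let e := ContinuousLinearEquiv.ofBijective B inj (LinearMap.range_eq_top.2 surj)
  have he : (e : (H × H) →L[ℝ] _) = B := ContinuousLinearEquiv.coe_ofBijective ..
  have hB : B.IsInvertible := ⟨e, he⟩
  refine ⟨hB, ?_⟩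
  rw [← he, ContinuousLinearMap.inverse_equiv]
  refine ContinuousLinearMap.opNorm_le_bound _ (by positivity) fun y => ?_
  have := bound (e.symm y)
  rwa [← he, ContinuousLinearEquiv.coe_coe, e.apply_symm_apply] at this

/-! ### Poincaré inequality -/

section Poincare

variable {N : ℕ}

/-- The Poincaré inequality for test functions supported in a ball of radius `R`. -/
theorem integral_sq_le_of_contDiff (hN : 1 ≤ N) {φ : EuclideanSpace ℝ (Fin N) → ℝ}
    (hφ : ContDiff ℝ 1 φ) (hc : HasCompactSupport φ) {R : ℝ}
    (hR : ∀ x, φ x ≠ 0 → ‖x‖ ≤ R) :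
    ∫ x, φ x ^ 2 ≤ 4 * R ^ 2 * ∫ x, ‖gradient φ x‖ ^ 2 := by
  -- With `g` the first coordinate, `∂ᵥ g = 1`, so integration by parts gives `∫ φ² = -∫ ∂ᵥ(φ²) g`,
  -- where `|g| ≤ R` wherever `φ ≠ 0`.
  let v : EuclideanSpace ℝ (Fin N) := EuclideanSpace.single ⟨0, hN⟩ 1
  have hv : ‖v‖ = 1 := by simp [v]
  let g : EuclideanSpace ℝ (Fin N) →L[ℝ] ℝ := innerSL ℝ v
  have hgv : g v = 1 := by simp [g, hv]
  have hd : Differentiable ℝ φ := hφ.differentiable (by simp)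
  have hd2 : ∀ x, fderiv ℝ (fun x => φ x ^ 2) x v = 2 * φ x * fderiv ℝ φ x v := fun x => by
    rw [((hd x).hasFDerivAt.pow 2).fderiv]
    simp
  have cf : Continuous fun x => fderiv ℝ φ x v :=
    (hφ.continuous_fderiv (by simp)).clm_apply continuous_const
  have hnorm : ∀ x, ‖gradient φ x‖ = ‖fderiv ℝ φ x‖ := fun x => by simp [gradient]
  have int1 : Integrable fun x => fderiv ℝ (fun x => φ x ^ 2) x v * g x := by
    simp_rw [hd2]
    refine Continuous.integrable_of_hasCompactSupport
      (((continuous_const.mul hφ.continuous).mul cf).mul g.continuous) ?_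
    exact (hc.mul_left.mul_right).mul_right
  have csq : HasCompactSupport fun x => φ x ^ 2 := by
    simp_rw [sq]; exact hc.mul_left
  have int0 : Integrable fun x => φ x ^ 2 :=
    (hφ.continuous.pow 2).integrable_of_hasCompactSupport csq
  have int2 : Integrable fun x => φ x ^ 2 * g x :=
    ((hφ.continuous.pow 2).mul g.continuous).integrable_of_hasCompactSupport csq.mul_right
  have int3 : Integrable fun x => ‖gradient φ x‖ ^ 2 := by
    simp_rw [hnorm, sq]
    refine Continuous.integrable_of_hasCompactSupport ?_ (hc.fderiv (𝕜 := ℝ)).norm.mul_left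
    exact (hφ.continuous_fderiv (by simp)).norm.mul (hφ.continuous_fderiv (by simp)).norm
  have parts := integral_mul_fderiv_eq_neg_fderiv_mul_of_integrable (𝕜 := ℝ) (v := v)
    (f := fun x => φ x ^ 2) (g := g) int1 (by simpa [hgv] using int0) int2
    (fun x _ => (hd x).pow 2) (fun x _ => g.differentiableAt)
  simp only [ContinuousLinearMap.fderiv, hgv, mul_one] at parts
  have pt : ∀ x, -(fderiv ℝ (fun x => φ x ^ 2) x v * g x) ≤
      2⁻¹ * φ x ^ 2 + 2 * R ^ 2 * ‖gradient φ x‖ ^ 2 := fun x => by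
    rw [hd2]
    by_cases h0 : φ x = 0
    · simp only [h0]
      have : 0 ≤ 2 * R ^ 2 * ‖gradient φ x‖ ^ 2 := by positivity
      linarith
    · have hgx : |g x| ≤ R := by
        have := abs_real_inner_le_norm v x
        rw [hv, one_mul] at this
        exact this.trans (hR x h0)
      have hfx : |fderiv ℝ φ x v| ≤ ‖gradient φ x‖ := by
        have := (fderiv ℝ φ x).le_opNorm v
        rwa [hv, mul_one, ← hnorm] at this
      have hp : |fderiv ℝ φ x v * g x| ≤ ‖gradient φ x‖ * R := by
        rw [abs_mul]; gcongr
      have hp2 : (fderiv ℝ φ x v * g x) ^ 2 ≤ (‖gradient φ x‖ * R) ^ 2 :=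
        sq_le_sq.2 (hp.trans (le_abs_self _))
      -- Young's inequality, weighted so that only `φ² / 2` appears on the right and can be absorbed
      -- after integration.
      nlinarith [sq_nonneg (φ x + 2 * (fderiv ℝ φ x v * g x))]
  have := integral_mono int1.neg ((int0.const_mul 2⁻¹).add (int3.const_mul (2 * R ^ 2))) pt
  rw [integral_add' (int0.const_mul _) (int3.const_mul _), integral_const_mul, integral_const_mul,
    integral_neg', ← parts] at this
  linarith

/-- Transfers the whole-space inequality for test functions to norms over `Ω`. -/
theorem norm_sq_L2_eq_integral {E : Type*} [NormedAddCommGroup E] [InnerProductSpace ℝ E]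
    {Ω : Set (EuclideanSpace ℝ (Fin N))} (u : Lp E 2 (vol Ω)) {f : EuclideanSpace ℝ (Fin N) → E}
    (h : u =ᵐ[vol Ω] f) (hf : ∀ x, x ∉ Ω → f x = 0) : ‖u‖ ^ 2 = ∫ x, ‖f x‖ ^ 2 := by
  have hs : ∀ x, x ∉ Ω → ‖f x‖ ^ 2 = 0 := fun x hx => by simp [hf x hx]
  rw [← real_inner_self_eq_norm_sq, L2.inner_def,
    ← setIntegral_eq_integral_of_forall_compl_eq_zero hs]
  refine integral_congr_ae ?_
  filter_upwards [h] with x hx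
  rw [hx, real_inner_self_eq_norm_sq]

/-- The Poincaré inequality on `H¹₀(Ω)` for bounded `Ω`. -/
theorem exists_poincare (hN : 1 ≤ N) {Ω : Set (EuclideanSpace ℝ (Fin N))}
    (hΩ : Bornology.IsBounded Ω) :
    ∃ P : ℝ, 0 < P ∧ ∀ u : H10 Ω, ‖toL2 Ω u‖ ^ 2 ≤ P * ‖grad Ω u‖ ^ 2 := by
  obtain ⟨R, hR0, hR⟩ := hΩ.exists_pos_norm_le
  refine ⟨4 * R ^ 2, by positivity, fun ⟨u, hu⟩ => ?_⟩
  change ‖u.fst‖ ^ 2 ≤ 4 * R ^ 2 * ‖u.snd‖ ^ 2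
  -- The inequality is a closed condition, so it passes from test pairs to their closure.
  have hcl : IsClosed {u : Graph Ω | ‖u.fst‖ ^ 2 ≤ 4 * R ^ 2 * ‖u.snd‖ ^ 2} :=
    isClosed_le ((WithLp.fstL 2 ℝ (L2 Ω) (L2Vec Ω)).continuous.norm.pow 2)
      (continuous_const.mul ((WithLp.sndL 2 ℝ (L2 Ω) (L2Vec Ω)).continuous.norm.pow 2))
  refine closure_minimal ?_ hcl hu
  rintro p ⟨φ, hφ, h1, h2⟩
  have h0 : ∀ x, x ∉ Ω → φ x = 0 := fun x hx =>
    image_eq_zero_of_notMem_tsupport fun h => hx (hφ.supp h)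
  have h0' : ∀ x, x ∉ Ω → gradient φ x = 0 := fun x hx => by
    have : fderiv ℝ φ x = 0 := image_eq_zero_of_notMem_tsupport
      fun h => hx (hφ.supp (tsupport_fderiv_subset ℝ h))
    simp [gradient, this]
  change ‖p.fst‖ ^ 2 ≤ 4 * R ^ 2 * ‖p.snd‖ ^ 2
  rw [norm_sq_L2_eq_integral _ h1 h0, norm_sq_L2_eq_integral _ h2 h0']
  simpa using integral_sq_le_of_contDiff hN (hφ.smooth.of_le (by simp)) hφ.compact
    fun x hx => hR x (not_not.1 fun h => hx (h0 x h))

end Poincare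

/-! ### Coercivity estimates in the two regimes -/

section Energy

variable {N : ℕ} {Ω : Set (EuclideanSpace ℝ (Fin N))}

theorem norm_sq_H10 (u : H10 Ω) : ‖u‖ ^ 2 = ‖toL2 Ω u‖ ^ 2 + ‖grad Ω u‖ ^ 2 :=
  WithLp.prod_norm_sq_eq_of_L2 (u : Graph Ω)

theorem norm_mulLinf_le (d : Lp ℝ ∞ (vol Ω)) (f : L2 Ω) : ‖mulLinf Ω d f‖ ≤ ‖d‖ * ‖f‖ := by
  have := (ContinuousLinearMap.mul ℝ ℝ).norm_holder_apply_apply_le (r := 2) d f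
  rw [ContinuousLinearMap.opNorm_mul, one_mul] at this
  exact this

theorem inner_mulLinf_self_nonneg {d : Lp ℝ ∞ (vol Ω)} (hd : ∀ᵐ x ∂(vol Ω), 0 ≤ d x) (f : L2 Ω) :
    0 ≤ inner ℝ (mulLinf Ω d f) f := by
  rw [L2.inner_def]
  refine integral_nonneg_of_ae ?_
  filter_upwards [hd, mulLinf_coe Ω d f] with x hx h
  rw [h]
  simpa [mul_comm, mul_left_comm] using mul_nonneg hx (mul_self_nonneg (f x))

/-- The form of `B` tested against `(a w + ψ, b w - a ψ)`. -/
theorem blockOp_test (α a b : ℝ) (d : Lp ℝ ∞ (vol Ω)) (w ψ : H10 Ω) :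
    (blockOp Ω α d (w, ψ)).1 (a • w + ψ) + (blockOp Ω α d (w, ψ)).2 (b • w - a • ψ) =
      a * α⁻¹ * ‖toL2 Ω w‖ ^ 2 + α⁻¹ * inner ℝ (toL2 Ω w) (toL2 Ω ψ) + ‖grad Ω ψ‖ ^ 2 +
      b * ‖grad Ω w‖ ^ 2 - b * inner ℝ (mulLinf Ω d (toL2 Ω ψ)) (toL2 Ω w) +
      a * inner ℝ (mulLinf Ω d (toL2 Ω ψ)) (toL2 Ω ψ) := by
  have hI : ∀ u v, idOp Ω u v = inner ℝ (toL2 Ω u) (toL2 Ω v) := fun u v => rfl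
  have hL : ∀ u v, negLap Ω u v = inner ℝ (grad Ω u) (grad Ω v) := fun u v => rfl
  have hD : ∀ u v, mulOp Ω d u v = inner ℝ (mulLinf Ω d (toL2 Ω u)) (toL2 Ω v) := fun u v => rfl
  simp only [blockOp_apply, add_apply, sub_apply, smul_apply, map_add, map_sub, map_smul, hI, hL, hD,
    smul_eq_mul, real_inner_self_eq_norm_sq, real_inner_comm (grad Ω w) (grad Ω ψ)]
  ring

instance : CompleteSpace (H10 Ω) :=
  (testPairs Ω).isClosed_topologicalClosure.completeSpace_coe

/-- The Poincaré inequality controls the norm of `H¹₀(Ω)` by that of the gradient. -/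
theorem inv_mul_norm_sq_H10_le {P : ℝ} (hP : 0 < P) {u : H10 Ω}
    (hp : ‖toL2 Ω u‖ ^ 2 ≤ P * ‖grad Ω u‖ ^ 2) : (1 + P)⁻¹ * ‖u‖ ^ 2 ≤ ‖grad Ω u‖ ^ 2 := by
  rw [inv_mul_le_iff₀ (by positivity), norm_sq_H10]
  linarith

theorem inner_mulLinf_le {M : ℝ} {d : Lp ℝ ∞ (vol Ω)} (hd : ‖d‖ ≤ M) (f g : L2 Ω) :
    inner ℝ (mulLinf Ω d f) g ≤ M * (‖f‖ * ‖g‖) := by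
  refine (real_inner_le_norm _ _).trans ?_
  rw [← mul_assoc]
  gcongr
  exact (norm_mulLinf_le d f).trans (by gcongr)

/-- Here `b = 1` and `a = α P (α⁻¹ + M)² / 2`; the sign of `d` makes `a ∫ d ψ²` harmless however
large `a` is. -/
theorem isInvertible_blockOp_of_nonneg {P : ℝ} (hP : 0 < P)
    (hp : ∀ u : H10 Ω, ‖toL2 Ω u‖ ^ 2 ≤ P * ‖grad Ω u‖ ^ 2) {M α : ℝ} (hM : 0 < M) (hα : 0 < α)
    {d : Lp ℝ ∞ (vol Ω)} (hdM : ‖d‖ ≤ M) (hd : ∀ᵐ x ∂(vol Ω), 0 ≤ d x) :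
    (blockOp Ω α d).IsInvertible ∧ ‖(blockOp Ω α d).inverse‖ ≤
      (1 + 2 * (α * (P * (α⁻¹ + M) ^ 2 / 2)) + 1) / (2⁻¹ * (1 + P)⁻¹) := by
  refine isInvertible_of_block_coercive _ (by positivity) one_pos (by positivity) fun w ψ => ?_
  rw [blockOp_test]
  have h1 := inv_mul_norm_sq_H10_le hP (hp w)
  have h2 := inv_mul_norm_sq_H10_le hP (hp ψ)
  have h3 := mul_le_mul_of_nonneg_left
    (neg_le_of_abs_le (abs_real_inner_le_norm (toL2 Ω w) (toL2 Ω ψ))) (inv_nonneg.2 hα.le)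
  have h4 := inner_mulLinf_le hdM (toL2 Ω ψ) (toL2 Ω w)
  have h5 : 0 ≤ α * (P * (α⁻¹ + M) ^ 2 / 2) *
      inner ℝ (mulLinf Ω d (toL2 Ω ψ)) (toL2 Ω ψ) :=
    mul_nonneg (by positivity) (inner_mulLinf_self_nonneg hd _)
  have h6 : α * (P * (α⁻¹ + M) ^ 2 / 2) * α⁻¹ = P * (α⁻¹ + M) ^ 2 / 2 := by field_simp
  rw [h6]
  have h7 : 0 ≤ P * (α⁻¹ + M) ^ 2 / 2 * ‖toL2 Ω w‖ ^ 2 - (α⁻¹ + M) * ‖toL2 Ω w‖ * ‖toL2 Ω ψ‖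
      + ‖grad Ω ψ‖ ^ 2 / 2 := by
    -- After multiplication by `P`, Poincaré for `ψ` bounds the expression below by half of the
    -- square supplied next.
    refine nonneg_of_mul_nonneg_right ?_ hP
    nlinarith [hp ψ, sq_nonneg (P * (α⁻¹ + M) * ‖toL2 Ω w‖ - ‖toL2 Ω ψ‖)]
  have h8 := sq_nonneg ‖grad Ω w‖
  linarith

/-- With `a = 0` the gradient terms alone must absorb the cross terms; `b = (4 M² P²)⁻¹` balances
Young's inequality because `b (2 M P)² = 1`. -/
theorem isInvertible_blockOp_of_le {P : ℝ} (hP : 0 < P)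
    (hp : ∀ u : H10 Ω, ‖toL2 Ω u‖ ^ 2 ≤ P * ‖grad Ω u‖ ^ 2) {M α : ℝ} (hM : 0 < M)
    (hα : 4 * M * P ^ 2 ≤ α) {d : Lp ℝ ∞ (vol Ω)} (hdM : ‖d‖ ≤ M) :
    (blockOp Ω α d).IsInvertible ∧ ‖(blockOp Ω α d).inverse‖ ≤
      (1 + 2 * 0 + (4 * M ^ 2 * P ^ 2)⁻¹) /
        (2⁻¹ * min 1 (4 * M ^ 2 * P ^ 2)⁻¹ * (1 + P)⁻¹) := by
  have hα0 : 0 < α := lt_of_lt_of_le (by positivity) hα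
  obtain ⟨b, hb⟩ : ∃ b, b = (4 * M ^ 2 * P ^ 2)⁻¹ := ⟨_, rfl⟩
  have hb0 : 0 < b := hb ▸ by positivity
  rw [← hb]
  have hbM : b * (4 * M ^ 2 * P ^ 2) = 1 := by rw [hb]; field_simp
  -- The threshold on `α` makes the `α⁻¹` cross term no worse than the one from `d`.
  have hαb : α⁻¹ ≤ b * M := by
    refine (inv_anti₀ (by positivity) hα).trans_eq ?_
    rw [hb]; field_simp
  refine isInvertible_of_block_coercive _ le_rfl hb0 (by positivity) fun w ψ => ?_
  rw [blockOp_test]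
  have h1 := inv_mul_norm_sq_H10_le hP (hp w)
  have h2 := inv_mul_norm_sq_H10_le hP (hp ψ)
  have h3 := mul_le_mul_of_nonneg_left
    (neg_le_of_abs_le (abs_real_inner_le_norm (toL2 Ω w) (toL2 Ω ψ))) (inv_nonneg.2 hα0.le)
  have h4 := mul_le_mul_of_nonneg_left (inner_mulLinf_le hdM (toL2 Ω ψ) (toL2 Ω w)) hb0.le
  have h5 : ‖toL2 Ω w‖ * ‖toL2 Ω ψ‖ ≤ P * (‖grad Ω w‖ * ‖grad Ω ψ‖) := by
    refine abs_le_of_sq_le_sq' ?_ (by positivity) |>.2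
    calc (‖toL2 Ω w‖ * ‖toL2 Ω ψ‖) ^ 2 = ‖toL2 Ω w‖ ^ 2 * ‖toL2 Ω ψ‖ ^ 2 := by ring
      _ ≤ (P * ‖grad Ω w‖ ^ 2) * (P * ‖grad Ω ψ‖ ^ 2) := by gcongr <;> apply hp
      _ = _ := by ring
  have h6 : α⁻¹ * (‖toL2 Ω w‖ * ‖toL2 Ω ψ‖) ≤ b * M * (P * (‖grad Ω w‖ * ‖grad Ω ψ‖)) := by
    gcongr
  have h7 : b * M * (‖toL2 Ω w‖ * ‖toL2 Ω ψ‖) ≤ b * M * (P * (‖grad Ω w‖ * ‖grad Ω ψ‖)) := by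
    gcongr
  have h8 : 2 * (b * M * (P * (‖grad Ω w‖ * ‖grad Ω ψ‖))) ≤
      2⁻¹ * ‖grad Ω ψ‖ ^ 2 + 2⁻¹ * b * ‖grad Ω w‖ ^ 2 := by
    have e : b * (2 * M * P * ‖grad Ω ψ‖) ^ 2 = ‖grad Ω ψ‖ ^ 2 := by
      linear_combination ‖grad Ω ψ‖ ^ 2 * hbM
    nlinarith [mul_nonneg hb0.le (sq_nonneg (‖grad Ω w‖ - 2 * M * P * ‖grad Ω ψ‖))]
  have h9 : min 1 b * ((1 + P)⁻¹ * ‖w‖ ^ 2) ≤ b * ‖grad Ω w‖ ^ 2 := by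
    gcongr
    exact min_le_right _ _
  have h10 : min 1 b * ((1 + P)⁻¹ * ‖ψ‖ ^ 2) ≤ 1 * ‖grad Ω ψ‖ ^ 2 := by
    gcongr
    exact min_le_left _ _
  linarith

end Energy

theorem lemma5p3 {N : ℕ} (hN : 1 ≤ N) (Ω : Set (EuclideanSpace ℝ (Fin N)))
    (hΩ : IsOpen Ω) (hΩb : Bornology.IsBounded Ω) :
    ∃ (α₀ : ℝ → ℝ) (C : ℝ → ℝ → ℝ), ∀ (M : ℝ), 0 < M → ∀ (α : ℝ), 0 < α →
      ∀ d : Lp ℝ ∞ (BlockOp.vol Ω), ‖d‖ ≤ M →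
        ((∀ᵐ x ∂(BlockOp.vol Ω), 0 ≤ d x) ∨ α₀ M ≤ α) →
          (BlockOp.blockOp Ω α d).IsInvertible ∧ ‖(BlockOp.blockOp Ω α d).inverse‖ ≤ C α M := by
  obtain ⟨P, hP, hp⟩ := exists_poincare hN hΩb
  refine ⟨fun M => 4 * M * P ^ 2, fun α M => max
    ((1 + 2 * (α * (P * (α⁻¹ + M) ^ 2 / 2)) + 1) / (2⁻¹ * (1 + P)⁻¹))
    ((1 + 2 * 0 + (4 * M ^ 2 * P ^ 2)⁻¹) / (2⁻¹ * min 1 (4 * M ^ 2 * P ^ 2)⁻¹ * (1 + P)⁻¹)),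
    fun M hM α hα d hdM h => ?_⟩
  rcases h with hd | hα₀
  · exact (isInvertible_blockOp_of_nonneg hP hp hM hα hdM hd).imp_right (le_max_of_le_left ·)
  · exact (isInvertible_blockOp_of_le hP hp hM hα₀ hdM).imp_right (le_max_of_le_right ·)
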